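/- Let $f:\mathbb{R}^n\to\mathbb{R}^n$ be locally Lipschitz, i.e. every point of $\mathbb{R}^n$ has a neighbourhood on which $f$ is Lipschitz. For $x\in\mathbb{R}^n$ let $$\partial f(x)=\operatorname{co}\Bigl\{\lim_{i\to\infty} Df(x_i)\;:\; x_i\to x,\ f \text{ is differentiable at each } x_i,\ \text{and the limit exists}\Bigr\}$$ be the Clarke generalized Jacobian of $f$ at $x$, where $\operatorname{co}$ denotes the convex hull. Assume that 1. for every $y\in\mathbb{R}^n$ the functional $\varphi_y(x)=\tfrac12\|f(x)-y\|^2$ is coercive, i.e. $\varphi_y(x)\to+\infty$ as $\|x\|\to\infty$; 2. for every $x\in\mathbb{R}^n$ the set $\partial f(x)$ is of maximal rank, i.e. every matrix in $\partial f(x)$ is nonsingular. Then $f$ is a homeomorphism of $\mathbb{R}^n$ onto $\mathbb{R}^n$, and $f^{-1}$ is locally Lipschitz. -/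

import Mathlib

open Filter Topology

/-- The limits of Jacobians `Df(uᵢ)` along sequences `uᵢ → x` of points of differentiability
of `f` (the B-subdifferential of `f` at `x`). -/
def limitingJacobian {n k : ℕ}
    (f : EuclideanSpace ℝ (Fin n) → EuclideanSpace ℝ (Fin k)) (x : EuclideanSpace ℝ (Fin n)) :
    Set (EuclideanSpace ℝ (Fin n) →L[ℝ] EuclideanSpace ℝ (Fin k)) :=
  {A | ∃ u : ℕ → EuclideanSpace ℝ (Fin n),
    (∀ i, DifferentiableAt ℝ f (u i)) ∧ Tendsto u atTop (𝓝 x) ∧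
      Tendsto (fun i => fderiv ℝ f (u i)) atTop (𝓝 A)}

/-- Clarke's generalized Jacobian `∂f(x)`: the convex hull of all limits of Jacobians of `f`
at points of differentiability converging to `x`. Matrices are regarded as linear maps. -/
def clarkeJacobian {n k : ℕ}
    (f : EuclideanSpace ℝ (Fin n) → EuclideanSpace ℝ (Fin k)) (x : EuclideanSpace ℝ (Fin n)) :
    Set (EuclideanSpace ℝ (Fin n) →L[ℝ] EuclideanSpace ℝ (Fin k)) :=
  convexHull ℝ (limitingJacobian f x)

/-- A set of square matrices is of maximal rank if all its members are nonsingular. -/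
def IsOfMaximalRank {n : ℕ}
    (S : Set (EuclideanSpace ℝ (Fin n) →L[ℝ] EuclideanSpace ℝ (Fin n))) : Prop :=
  ∀ A ∈ S, A.det ≠ 0

/-- A functional is coercive if `φ(x) → +∞` as `‖x‖ → ∞`. -/
def IsCoerciveFunctional {n : ℕ} (φ : EuclideanSpace ℝ (Fin n) → ℝ) : Prop :=
  Tendsto φ (comap (fun x => ‖x‖) atTop) atTop

/-! By Rademacher's theorem and Fubini, the scalar mean value inequality holds for a Lipschitz
function whose derivative is bounded below almost everywhere; with Hahn–Banach this gives Clarke's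
mean value theorem: near `x` every increment of `f` is `A (b - a)` with `A` in a small compact
convex neighbourhood of `∂f(x)`, hence `A` invertible. Therefore `f` is expanding near `x`, and it
is open because a point minimising `‖f - y‖` locally must solve `f z = y`: otherwise one direction
decreases this norm for all `A` at once. So `f` is a local homeomorphism with locally Lipschitz
inverse. Coercivity makes `f` proper, hence a covering map of a simply connected space, hence a
bijection.
-/

open Bornology MeasureTheory Set

section ConvexHull

variable {E : Type*} [NormedAddCommGroup E] [NormedSpace ℝ E] {s : Set E}

/-- The set of all convex combinations of `m` points of `s`, repetitions allowed. -/
def convexCombinations (m : ℕ) (s : Set E) : Set E :=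
  (fun p : (Fin m → ℝ) × (Fin m → E) => ∑ i, p.1 i • p.2 i) ''
    (stdSimplex ℝ (Fin m) ×ˢ univ.pi fun _ => s)

theorem convexCombinations_subset_convexHull (m : ℕ) (s : Set E) :
    convexCombinations m s ⊆ convexHull ℝ s := by
  rintro _ ⟨⟨w, z⟩, ⟨⟨hw_nonneg, hw_sum⟩, hz⟩, rfl⟩
  exact (convex_convexHull ℝ s).sum_mem (fun i _ => hw_nonneg i) hw_sum
    fun i _ => subset_convexHull ℝ s (hz i trivial)

theorem isCompact_convexCombinations (m : ℕ) (hs : IsCompact s) :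
    IsCompact (convexCombinations m s) :=
  ((isCompact_stdSimplex ℝ (Fin m)).prod (isCompact_univ_pi fun _ => hs)).image (by fun_prop)

theorem convexHull_eq_biUnion_convexCombinations [FiniteDimensional ℝ E] (s : Set E) :
    convexHull ℝ s = ⋃ m ∈ Finset.range (Module.finrank ℝ E + 2), convexCombinations m s := by
  refine Subset.antisymm (fun x hx => ?_)
    (iUnion₂_subset fun m _ => convexCombinations_subset_convexHull m s)
  obtain ⟨ι, _, z, w, hz, hind, hw_pos, hw_sum, rfl⟩ := eq_pos_convex_span_of_mem_convexHull hx
  have hcard : Fintype.card ι ≤ Module.finrank ℝ E + 1 :=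
    hind.card_le_finrank_succ.trans (Nat.succ_le_succ (Submodule.finrank_le _))
  let e := Fintype.equivFin ι
  refine mem_biUnion (Finset.mem_coe.2 (Finset.mem_range.2 (Nat.lt_succ_of_le hcard)))
    ⟨(w ∘ e.symm, z ∘ e.symm), ⟨⟨fun i => (hw_pos _).le, ?_⟩, fun i _ => hz ⟨_, rfl⟩⟩, ?_⟩
  · exact (e.symm.sum_comp w).trans hw_sum
  · exact e.symm.sum_comp fun i => w i • z i

theorem isCompact_convexHull [FiniteDimensional ℝ E] (hs : IsCompact s) :
    IsCompact (convexHull ℝ s) := by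
  rw [convexHull_eq_biUnion_convexCombinations]
  exact (Finset.range _).isCompact_biUnion fun m _ => isCompact_convexCombinations m hs

end ConvexHull

section MeanValueInequality

theorem mul_sub_le_of_ae_le_deriv {g : ℝ → ℝ} {a b c : ℝ} (hab : a ≤ b)
    (hg : AbsolutelyContinuousOnInterval g a b) (hc : ∀ᵐ t : ℝ, t ∈ Icc a b → c ≤ deriv g t) :
    c * (b - a) ≤ g b - g a :=
  calc c * (b - a) = ∫ _ in a..b, c := by simp [mul_comm]
    _ ≤ ∫ t in a..b, deriv g t :=
      intervalIntegral.integral_mono_ae_restrict hab intervalIntegrable_const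
        hg.intervalIntegrable_deriv ((ae_restrict_iff' measurableSet_Icc).2 hc)
    _ = g b - g a := hg.integral_deriv_eq_sub

variable {E : Type*} [NormedAddCommGroup E] [NormedSpace ℝ E]

theorem deriv_comp_add_smul_eq_lineDeriv {F : Type*} [NormedAddCommGroup F] [NormedSpace ℝ F]
    (f : E → F) (x v : E) (t : ℝ) :
    deriv (fun s : ℝ => f (x + s • v)) t = lineDeriv ℝ f (x + t • v) v := by
  have h := deriv_comp_const_add (fun s : ℝ => f (x + s • v)) t 0
  simpa only [lineDeriv, add_smul, add_assoc, add_zero, deriv_comp_const_add] using h.symm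

variable {φ : E → ℝ} {C : NNReal} {U : Set E} {v x : E} {c : ℝ}

theorem le_sub_of_ae_le_lineDeriv_segment (hφ : LipschitzOnWith C φ U) (hconv : Convex ℝ U)
    (hx : x ∈ U) (hxv : x + v ∈ U)
    (hc : ∀ᵐ t : ℝ, x + t • v ∈ U → c ≤ lineDeriv ℝ φ (x + t • v) v) :
    c ≤ φ (x + v) - φ x := by
  have hseg : MapsTo (fun t : ℝ => x + t • v) (Icc 0 1) U := fun t ht =>
    hconv.add_smul_mem hx hxv ht
  have hline : LipschitzWith ‖v‖₊ fun t : ℝ => x + t • v :=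
    LipschitzWith.of_dist_le_mul fun a b => by
      simp [dist_eq_norm, ← sub_smul, norm_smul, mul_comm]
  have hac : AbsolutelyContinuousOnInterval (fun t : ℝ => φ (x + t • v)) 0 1 := by
    refine LipschitzOnWith.absolutelyContinuousOnInterval (K := C * ‖v‖₊) ?_
    rw [uIcc_of_le zero_le_one]
    exact hφ.comp hline.lipschitzOnWith hseg
  have hderiv : ∀ᵐ t : ℝ, t ∈ Icc (0 : ℝ) 1 → c ≤ deriv (fun s : ℝ => φ (x + s • v)) t := by
    filter_upwards [hc] with t ht ht01
    rw [deriv_comp_add_smul_eq_lineDeriv]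
    exact ht (hseg ht01)
  simpa using mul_sub_le_of_ae_le_deriv zero_le_one hac hderiv

variable [FiniteDimensional ℝ E] [MeasurableSpace E] [BorelSpace E] {μ : Measure E}
  [μ.IsAddHaarMeasure]

theorem ae_ae_add_smul_of_ae {p : E → Prop} (hp : ∀ᵐ x ∂μ, p x) (v : E) :
    ∀ᵐ x ∂μ, ∀ᵐ t : ℝ, p (x + t • v) := by
  obtain ⟨s, hs, hs_meas, hsp⟩ := hp.exists_measurable_mem
  let line : ℝ →ₗ[ℝ] E := LinearMap.toSpanSingleton ℝ E v
  filter_upwards [(ae_ae_add_linearMap_mem_iff line volume μ hs_meas).2 hs] with x hx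
  filter_upwards [hx] with t ht
  exact hsp _ ht

-- By Fubini the bound holds a.e. on almost every parallel segment; continuity then reaches the
-- segment from `x` to `x + v`, which may itself lie in the exceptional null set.
theorem le_sub_of_ae_le_lineDeriv (hφ : LipschitzOnWith C φ U) (hU : IsOpen U)
    (hconv : Convex ℝ U) (hc : ∀ᵐ u ∂μ, u ∈ U → c ≤ lineDeriv ℝ φ u v)
    (hx : x ∈ U) (hxv : x + v ∈ U) : c ≤ φ (x + v) - φ x := by
  have hadd : Tendsto (fun z => z + v) (𝓝 x) (𝓝 (x + v)) := (continuous_add_const v).tendsto x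
  have hlim : Tendsto (fun z => φ (z + v) - φ z) (𝓝 x) (𝓝 (φ (x + v) - φ x)) :=
    ((hφ.continuousOn.continuousAt (hU.mem_nhds hxv)).tendsto.comp hadd).sub
      (hφ.continuousOn.continuousAt (hU.mem_nhds hx)).tendsto
  have hgood : ∃ᶠ z in 𝓝 x, ∀ᵐ t : ℝ, z + t • v ∈ U → c ≤ lineDeriv ℝ φ (z + t • v) v :=
    mem_closure_iff_frequently.1 (Measure.dense_of_ae (ae_ae_add_smul_of_ae hc v) x)
  have hmem : ∀ᶠ z in 𝓝 x, z ∈ U ∧ z + v ∈ U :=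
    (hU.eventually_mem hx).and (hadd.eventually (hU.eventually_mem hxv))
  exact ge_of_tendsto_of_frequently hlim <| (hgood.and_eventually hmem).mono
    fun z ⟨hz, hzU, hzvU⟩ => le_sub_of_ae_le_lineDeriv_segment hφ hconv hzU hzvU hz

end MeanValueInequality

section InvertibleOperators

variable {E F : Type*} [NormedAddCommGroup E] [NormedSpace ℝ E] [NormedAddCommGroup F]
  [NormedSpace ℝ F] {K : Set (E →L[ℝ] F)}

theorem exists_norm_le_mul_norm_apply [CompleteSpace E] (hK : IsCompact K)
    (hinv : ∀ A ∈ K, A.IsInvertible) : ∃ C : NNReal, ∀ A ∈ K, ∀ v, ‖v‖ ≤ C * ‖A v‖ := by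
  have hcont : ContinuousOn ContinuousLinearMap.inverse K := by
    intro A hA
    obtain ⟨e, rfl⟩ := hinv A hA
    exact (contDiffAt_map_inverse (n := 0) e).continuousAt.continuousWithinAt
  obtain ⟨C, hC⟩ := hK.exists_bound_of_continuousOn hcont
  refine ⟨C.toNNReal, fun A hA v => ?_⟩
  calc ‖v‖ = ‖A.inverse (A v)‖ := by rw [(hinv A hA).inverse_apply_eq.2 rfl]
    _ ≤ ‖A.inverse‖ * ‖A v‖ := A.inverse.le_opNorm _
    _ ≤ C.toNNReal * ‖A v‖ := by
      gcongr
      exact (hC A hA).trans (Real.le_coe_toNNReal C)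

theorem exists_dual_eq_apply [FiniteDimensional ℝ E] (Φ : (E →L[ℝ] ℝ) →L[ℝ] ℝ) :
    ∃ w : E, ∀ l : E →L[ℝ] ℝ, Φ l = l w :=
  let Ψ : Module.Dual ℝ (Module.Dual ℝ E) :=
    Φ.toLinearMap ∘ₗ LinearMap.toContinuousLinearMap.toLinearMap
  ⟨(Module.evalEquiv ℝ E).symm Ψ,
    fun l => (Module.apply_evalEquiv_symm_apply ℝ E l.toLinearMap Ψ).symm⟩

-- The functionals `l ∘ A` form a compact convex set missing `0`; separate it from `0`.
theorem exists_forall_lt_apply_apply [FiniteDimensional ℝ E] (hK : IsCompact K)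
    (hconv : Convex ℝ K) (hsurj : ∀ A ∈ K, Function.Surjective A) {l : F →L[ℝ] ℝ} (hl : l ≠ 0) :
    ∃ w : E, ∃ c > 0, ∀ A ∈ K, c < l (A w) := by
  let L := ContinuousLinearMap.compL ℝ E F ℝ l
  have hzero : 0 ∉ L '' K := by
    rintro ⟨A, hA, hlA⟩
    refine hl (ContinuousLinearMap.ext fun y => ?_)
    obtain ⟨v, rfl⟩ := hsurj A hA y
    exact DFunLike.congr_fun hlA v
  obtain ⟨Φ, c, hc, hΦ⟩ := geometric_hahn_banach_point_closed (hconv.linear_image L.toLinearMap)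
    (hK.image L.continuous).isClosed hzero
  obtain ⟨w, hw⟩ := exists_dual_eq_apply Φ
  exact ⟨w, c, by simpa using hc, fun A hA => (hΦ _ (mem_image_of_mem L hA)).trans_eq (hw _)⟩

end InvertibleOperators

section MeanValueSet

variable {E F : Type*} [NormedAddCommGroup E] [NormedSpace ℝ E] [NormedAddCommGroup F]
  [NormedSpace ℝ F]

/-- `K` is a mean value set for `f` on `U` if every increment of `f` between two points of `U` is
the value of some operator in `K` on the increment of the argument. It is the only information on
the derivatives of `f` that the inverse function theorem below needs. -/
def HasMeanValueSetOn (f : E → F) (K : Set (E →L[ℝ] F)) (U : Set E) : Prop :=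
  ∀ a ∈ U, ∀ b ∈ U, ∃ A ∈ K, f b - f a = A (b - a)

variable {f : E → F} {K : Set (E →L[ℝ] F)} {U V : Set E} {x : E}

namespace HasMeanValueSetOn

theorem mono (h : HasMeanValueSetOn f K U) (hVU : V ⊆ U) : HasMeanValueSetOn f K V :=
  fun a ha b hb => h a (hVU ha) b (hVU hb)

theorem clm_comp {G : Type*} [NormedAddCommGroup G] [NormedSpace ℝ G]
    (h : HasMeanValueSetOn f K U) (e : F →L[ℝ] G) :
    HasMeanValueSetOn (e ∘ f) (ContinuousLinearMap.compL ℝ E F G e '' K) U := by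
  intro a ha b hb
  obtain ⟨A, hA, hab⟩ := h a ha b hb
  exact ⟨_, mem_image_of_mem _ hA, by simp [← hab]⟩

theorem exists_lipschitzOnWith (h : HasMeanValueSetOn f K U) (hK : IsCompact K) :
    ∃ C, LipschitzOnWith C f U := by
  obtain ⟨C, hC⟩ := hK.exists_bound_of_continuousOn continuousOn_id
  refine ⟨C.toNNReal, LipschitzOnWith.of_dist_le_mul fun b hb a ha => ?_⟩
  obtain ⟨A, hA, hab⟩ := h a ha b hb
  rw [dist_eq_norm, dist_eq_norm, hab]
  exact A.le_of_opNorm_le ((hC A hA).trans (Real.le_coe_toNNReal C)) _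

theorem exists_antilipschitzWith [CompleteSpace E] (h : HasMeanValueSetOn f K U)
    (hK : IsCompact K) (hinv : ∀ A ∈ K, A.IsInvertible) :
    ∃ C, AntilipschitzWith C (U.domRestrict f) := by
  obtain ⟨C, hC⟩ := exists_norm_le_mul_norm_apply hK hinv
  refine ⟨C, AntilipschitzWith.of_le_mul_dist ?_⟩
  rintro ⟨b, hb⟩ ⟨a, ha⟩
  obtain ⟨A, hA, hab⟩ := h a ha b hb
  simpa only [Subtype.dist_eq, domRestrict_apply, dist_eq_norm, hab] using hC A hA (b - a)

end HasMeanValueSetOn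

/-- `f` is regular at `x` if near `x` it has a compact convex mean value set consisting of
invertible operators: the hypothesis of the nonsmooth inverse function theorem. -/
def IsMeanValueRegularAt (f : E → F) (x : E) : Prop :=
  ∃ K U, IsCompact K ∧ Convex ℝ K ∧ (∀ A ∈ K, A.IsInvertible) ∧ U ∈ 𝓝 x ∧ HasMeanValueSetOn f K U

namespace IsMeanValueRegularAt

theorem continuousAt (h : IsMeanValueRegularAt f x) : ContinuousAt f x := by
  obtain ⟨K, U, hK, -, -, hU, hmean⟩ := h
  obtain ⟨C, hC⟩ := hmean.exists_lipschitzOnWith hK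
  exact hC.continuousOn.continuousAt hU

theorem exists_antilipschitzWith [CompleteSpace E] (h : IsMeanValueRegularAt f x) :
    ∃ U ∈ 𝓝 x, ∃ C, AntilipschitzWith C (U.domRestrict f) := by
  obtain ⟨K, U, hK, -, hinv, hU, hmean⟩ := h
  exact ⟨U, hU, hmean.exists_antilipschitzWith hK hinv⟩

end IsMeanValueRegularAt

theorem locallyLipschitz_symm_of_isMeanValueRegularAt [CompleteSpace E] (h : E ≃ₜ F)
    (hreg : ∀ x, IsMeanValueRegularAt h x) : LocallyLipschitz h.symm := by
  intro y
  obtain ⟨U, hU, C, hC⟩ := (hreg (h.symm y)).exists_antilipschitzWith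
  exact ⟨C, h.symm ⁻¹' U, h.symm.continuous.continuousAt hU, lipschitzOnWith_iff_restrict.2 <|
    hC.to_rightInvOn' (mapsTo_preimage _ _) fun z _ => h.apply_symm_apply z⟩

end MeanValueSet

section LocalInverse

variable {E F : Type*} [NormedAddCommGroup E] [NormedSpace ℝ E] [FiniteDimensional ℝ E]

section InnerProduct

variable [NormedAddCommGroup F] [InnerProductSpace ℝ F] {f : E → F} {K : Set (E →L[ℝ] F)}
  {U : Set E} {x : E} {y : F}

-- Along a direction `w` with `⟪y - f x, A w⟫ ≥ c` for all `A ∈ K`, the first-order decrease of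
-- `‖f - y‖ ^ 2` beats the quadratic error, uniformly in `A`.
theorem HasMeanValueSetOn.eq_of_isLocalMin_norm_sub (h : HasMeanValueSetOn f K U)
    (hK : IsCompact K) (hconv : Convex ℝ K) (hsurj : ∀ A ∈ K, Function.Surjective A)
    (hU : U ∈ 𝓝 x) (hmin : IsLocalMin (fun z => ‖f z - y‖) x) : f x = y := by
  by_contra hne
  have hl : innerSL ℝ (y - f x) ≠ 0 := fun h0 =>
    hne (sub_eq_zero.1 (inner_self_eq_zero.1 (DFunLike.congr_fun h0 (y - f x)))).symm
  obtain ⟨w, c, hc, hw⟩ := exists_forall_lt_apply_apply hK hconv hsurj hl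
  obtain ⟨M, hM⟩ := hK.exists_bound_of_continuousOn (f := fun A => A w) (by fun_prop)
  have hline : Tendsto (fun t : ℝ => x + t • w) (𝓝[>] 0) (𝓝 x) := by
    have : Continuous fun t : ℝ => x + t • w := by fun_prop
    simpa using (this.tendsto 0).mono_left nhdsWithin_le_nhds
  have hsmall : ∀ᶠ t : ℝ in 𝓝[>] 0, t * M ^ 2 < 2 * c := by
    have : Continuous fun t : ℝ => t * M ^ 2 := by fun_prop
    exact ((this.tendsto 0).mono_left nhdsWithin_le_nhds).eventually_lt_const (by simpa using hc)
  obtain ⟨t, ⟨⟨hle, htU⟩, htM⟩, ht : 0 < t⟩ := (((hline.eventually hmin).and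
    (hline.eventually_mem hU)).and hsmall |>.and self_mem_nhdsWithin).exists
  obtain ⟨A, hA, hincr⟩ := h x (mem_of_mem_nhds hU) _ htU
  have hsplit : f (x + t • w) - y = t • A w - (y - f x) := by
    rw [add_sub_cancel_left, map_smul] at hincr
    rw [← hincr]
    abel
  have hdecrease : ‖f (x + t • w) - y‖ ^ 2 < ‖f x - y‖ ^ 2 := by
    have hAw : ‖A w‖ ^ 2 ≤ M ^ 2 := by gcongr; exact hM A hA
    have hinner : c < inner ℝ (y - f x) (A w) := hw A hA
    rw [hsplit, norm_sub_sq_real, real_inner_smul_left, real_inner_comm, norm_smul,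
      Real.norm_of_nonneg ht.le, norm_sub_rev y]
    nlinarith [mul_lt_mul_of_pos_left htM ht, mul_lt_mul_of_pos_left hinner ht,
      mul_le_mul_of_nonneg_left hAw (sq_nonneg t)]
  exact hdecrease.not_ge (by gcongr)

-- A minimiser of `‖f - y‖` over a small ball around `x` is interior once `y` is close to `f x`,
-- because `f` is expanding there; hence it solves `f z = y`.
theorem HasMeanValueSetOn.image_mem_nhds_of_inner (h : HasMeanValueSetOn f K U)
    (hK : IsCompact K) (hconv : Convex ℝ K) (hinv : ∀ A ∈ K, A.IsInvertible) (hU : U ∈ 𝓝 x) :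
    f '' U ∈ 𝓝 (f x) := by
  obtain ⟨C, hC⟩ := h.exists_antilipschitzWith hK hinv
  obtain ⟨L, hL⟩ := h.exists_lipschitzOnWith hK
  obtain ⟨ρ, hρ, hρU⟩ := Metric.nhds_basis_closedBall.mem_iff.1 hU
  have hx : x ∈ Metric.closedBall x ρ := Metric.mem_closedBall_self hρ.le
  have hnear : ∀ᶠ y in 𝓝 (f x), C * (2 * ‖f x - y‖) < ρ := by
    have : Continuous fun y => C * (2 * ‖f x - y‖) := by fun_prop
    exact (this.tendsto (f x)).eventually_lt_const (by simpa using hρ)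
  filter_upwards [hnear] with y hy
  obtain ⟨z, hz, hzmin⟩ := (isCompact_closedBall x ρ).exists_isMinOn ⟨x, hx⟩
    (f := fun z => ‖f z - y‖) ((hL.continuousOn.mono hρU).sub continuousOn_const).norm
  have hzx : dist z x < ρ := calc
    dist z x ≤ C * dist (f z) (f x) := hC.le_mul_dist ⟨z, hρU hz⟩ ⟨x, hρU hx⟩
    _ ≤ C * (‖f z - y‖ + ‖f x - y‖) := by
      gcongr
      simpa only [dist_eq_norm] using dist_triangle_right (f z) (f x) y
    _ ≤ C * (2 * ‖f x - y‖) := by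
      gcongr
      linarith [isMinOn_iff.1 hzmin x hx]
    _ < ρ := hy
  have hball : Metric.closedBall x ρ ∈ 𝓝 z := Metric.closedBall_mem_nhds_of_mem hzx
  exact ⟨z, hρU hz, (h.mono hρU).eq_of_isLocalMin_norm_sub hK hconv
    (fun A hA => (hinv A hA).surjective) hball (hzmin.isLocalMin hball)⟩

end InnerProduct

variable [NormedAddCommGroup F] [NormedSpace ℝ F] [FiniteDimensional ℝ F] {f : E → F} {x : E}

theorem HasMeanValueSetOn.image_mem_nhds {K : Set (E →L[ℝ] F)} {U : Set E}
    (h : HasMeanValueSetOn f K U) (hK : IsCompact K) (hconv : Convex ℝ K)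
    (hinv : ∀ A ∈ K, A.IsInvertible) (hU : U ∈ 𝓝 x) : f '' U ∈ 𝓝 (f x) := by
  let e : F ≃L[ℝ] EuclideanSpace ℝ (Fin (Module.finrank ℝ F)) := toEuclidean
  let L := ContinuousLinearMap.compL ℝ E F _ e.toContinuousLinearMap
  have himage : e ∘ f '' U ∈ 𝓝 (e (f x)) :=
    (h.clm_comp e.toContinuousLinearMap).image_mem_nhds_of_inner (hK.image L.continuous)
      (hconv.linear_image L.toLinearMap)
      (forall_mem_image.2 fun A hA => ContinuousLinearMap.isInvertible_equiv.comp (hinv A hA)) hU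
  have := e.continuous.continuousAt.preimage_mem_nhds himage
  rwa [image_comp, preimage_image_eq _ e.injective] at this

theorem IsMeanValueRegularAt.nhds_le_map (h : IsMeanValueRegularAt f x) :
    𝓝 (f x) ≤ map f (𝓝 x) := by
  obtain ⟨K, U, hK, hconv, hinv, hU, hmean⟩ := h
  intro V hV
  have hUV : U ∩ f ⁻¹' V ∈ 𝓝 x := inter_mem hU hV
  refine mem_of_superset ((hmean.mono inter_subset_left).image_mem_nhds hK hconv hinv hUV) ?_
  exact image_subset_iff.2 inter_subset_right

theorem isLocalHomeomorph_of_isMeanValueRegularAt (h : ∀ x, IsMeanValueRegularAt f x) :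
    IsLocalHomeomorph f := by
  have hcont : Continuous f := continuous_iff_continuousAt.2 fun x => (h x).continuousAt
  have hopen : IsOpenMap f := .of_nhds_le fun x => (h x).nhds_le_map
  rw [isLocalHomeomorph_iff_isOpenEmbedding_restrict]
  intro x
  obtain ⟨U, hU, C, hC⟩ := (h x).exists_antilipschitzWith
  have hinj : InjOn f (interior U) := (injOn_iff_injective.2 hC.injective).mono interior_subset
  exact ⟨interior U, interior_mem_nhds.2 hU, .of_continuous_injective_isOpenMap
    (hcont.comp continuous_subtype_val) hinj.injective (hopen.domRestrict isOpen_interior)⟩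

end LocalInverse

section ProperLocalHomeomorph

variable {X Y : Type*} [TopologicalSpace X] [TopologicalSpace Y] {f : X → Y}

theorem isCoveringMap_of_isProperMap [T2Space X] (hf : IsLocalHomeomorph f)
    (hproper : IsProperMap f) : IsCoveringMap f := by
  have hfinite (y : Y) : (f ⁻¹' {y}).Finite :=
    (hproper.isCompact_preimage isCompact_singleton).finite <|
      IsDiscrete.of_openPartialHomeomorph f subset_rfl fun x _ =>
        (hf x).imp fun φ hφ => ⟨hφ.1, hφ.2.symm⟩
  exact isCoveringMap_iff_isCoveringMapOn_univ.2 <|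
    hproper.isClosedMap.isCoveringMapOn_of_isLocalHomeomorphOn (fun y _ => hfinite y)
      (isLocalHomeomorph_iff_isLocalHomeomorphOn_univ.1 hf)

theorem bijective_of_isCoveringMap [PreconnectedSpace X] [Nonempty X] [SimplyConnectedSpace Y]
    [LocallyPathConnectedSpace Y] (hf : IsCoveringMap f) : Function.Bijective f := by
  obtain ⟨x₀⟩ := ‹Nonempty X›
  obtain ⟨g, ⟨hg₀, hg⟩, -⟩ :=
    hf.existsUnique_continuousMap_lifts (ContinuousMap.id Y) (f x₀) x₀ rfl
  have hright : Function.RightInverse g f := congrFun hg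
  have hleft : g ∘ f = id := hf.eq_of_comp_eq (g.continuous.comp hf.continuous) continuous_id
    (funext fun x => hright (f x)) x₀ hg₀
  exact ⟨Function.LeftInverse.injective (congrFun hleft), hright.surjective⟩

end ProperLocalHomeomorph

theorem exists_homeomorph_of_isMeanValueRegularAt {E F : Type*} [NormedAddCommGroup E]
    [NormedSpace ℝ E] [FiniteDimensional ℝ E] [NormedAddCommGroup F] [NormedSpace ℝ F]
    [FiniteDimensional ℝ F] {f : E → F} (hreg : ∀ x, IsMeanValueRegularAt f x)
    (hcoercive : Tendsto f (cobounded E) (cobounded F)) :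
    ∃ h : E ≃ₜ F, ⇑h = f ∧ LocallyLipschitz h.symm := by
  have hlocal : IsLocalHomeomorph f := isLocalHomeomorph_of_isMeanValueRegularAt hreg
  have hproper : IsProperMap f := isProperMap_iff_tendsto_cocompact.2
    ⟨hlocal.continuous, by simpa only [Metric.cobounded_eq_cocompact] using hcoercive⟩
  have hbij : Function.Bijective f :=
    bijective_of_isCoveringMap (isCoveringMap_of_isProperMap hlocal hproper)
  exact ⟨hlocal.toHomeomorphOfBijective hbij, rfl,
    locallyLipschitz_symm_of_isMeanValueRegularAt _ hreg⟩

section ClarkeDerivative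

variable {E F : Type*} [NormedAddCommGroup E] [NormedSpace ℝ E] [NormedAddCommGroup F]
  [NormedSpace ℝ F]

/-- The limiting derivatives of `f` at `x` (its B-subdifferential): `limitingJacobian` for a map
between arbitrary normed spaces. -/
def limitingFDeriv (f : E → F) (x : E) : Set (E →L[ℝ] F) :=
  {A | ∃ u : ℕ → E, (∀ i, DifferentiableAt ℝ f (u i)) ∧ Tendsto u atTop (𝓝 x) ∧
    Tendsto (fun i => fderiv ℝ f (u i)) atTop (𝓝 A)}

/-- Clarke's generalized derivative: `clarkeJacobian` for a map between arbitrary normed spaces. -/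
def clarkeFDeriv (f : E → F) (x : E) : Set (E →L[ℝ] F) :=
  convexHull ℝ (limitingFDeriv f x)

theorem limitingFDeriv_eq_setOf_mapClusterPt (f : E → F) (x : E) :
    limitingFDeriv f x =
      {A | MapClusterPt A (𝓝[{u | DifferentiableAt ℝ f u}] x) (fderiv ℝ f)} := by
  ext A
  constructor
  · rintro ⟨u, hu, hux, huA⟩
    exact .of_comp (tendsto_nhdsWithin_iff.2 ⟨hux, .of_forall hu⟩) huA.mapClusterPt
  · intro hA
    have hfreq : ∃ᶠ u in 𝓝 x ⊓ comap (fderiv ℝ f) (𝓝 A), DifferentiableAt ℝ f u := by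
      rw [frequently_iff_neBot, inf_right_comm, neBot_inf_comap_iff_map, inf_comm]
      exact hA
    obtain ⟨u, hu, hdiff⟩ := exists_seq_forall_of_frequently hfreq
    exact ⟨u, hdiff, hu.mono_right inf_le_left, tendsto_comap_iff.1 (hu.mono_right inf_le_right)⟩

variable {f : E → F} {C : NNReal} {s : Set E} {x : E}

theorem map_fderiv_le_principal_closedBall (hs : s ∈ 𝓝 x) (hf : LipschitzOnWith C f s) :
    map (fderiv ℝ f) (𝓝[{u | DifferentiableAt ℝ f u}] x) ≤ 𝓟 (Metric.closedBall 0 (C : ℝ)) := by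
  refine tendsto_principal.2 (Eventually.filter_mono nhdsWithin_le_nhds ?_)
  filter_upwards [eventually_mem_nhds_iff.2 hs] with u hu
  exact mem_closedBall_zero_iff.2 (norm_fderiv_le_of_lipschitzOn ℝ hu hf)

variable [FiniteDimensional ℝ E] [FiniteDimensional ℝ F]

theorem isCompact_limitingFDeriv (hs : s ∈ 𝓝 x) (hf : LipschitzOnWith C f s) :
    IsCompact (limitingFDeriv f x) := by
  rw [limitingFDeriv_eq_setOf_mapClusterPt]
  refine (isCompact_closedBall 0 (C : ℝ)).of_isClosed_subset isClosed_setOfPred_clusterPt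
    fun A hA => ?_
  exact Metric.isClosed_closedBall.closure_subset <|
    mem_closure_iff_clusterPt.2 (hA.clusterPt.mono (map_fderiv_le_principal_closedBall hs hf))

theorem eventually_fderiv_mem {V : Set (E →L[ℝ] F)} (hs : s ∈ 𝓝 x) (hf : LipschitzOnWith C f s)
    (hV : IsOpen V) (hsub : limitingFDeriv f x ⊆ V) :
    ∀ᶠ u in 𝓝 x, DifferentiableAt ℝ f u → fderiv ℝ f u ∈ V := by
  have hmap : V ∈ map (fderiv ℝ f) (𝓝[{u | DifferentiableAt ℝ f u}] x) :=
    (isCompact_closedBall 0 (C : ℝ)).adherence_nhdset (map_fderiv_le_principal_closedBall hs hf) hV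
      fun _ _ hA => hsub ((limitingFDeriv_eq_setOf_mapClusterPt f x).superset hA)
  exact eventually_nhdsWithin_iff.1 hmap

-- If the increment were not of the form `A (b - a)` with `A ∈ K`, a functional would separate it
-- from these values, against the scalar mean value inequality.
theorem hasMeanValueSetOn_of_fderiv_mem {K : Set (E →L[ℝ] F)} {U : Set E}
    (hf : LipschitzOnWith C f U) (hU : IsOpen U) (hUconv : Convex ℝ U) (hK : IsCompact K)
    (hKconv : Convex ℝ K) (hmem : ∀ u ∈ U, DifferentiableAt ℝ f u → fderiv ℝ f u ∈ K) :
    HasMeanValueSetOn f K U := by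
  intro a ha b hb
  let ev := ContinuousLinearMap.apply ℝ F (b - a)
  suffices hincr : f b - f a ∈ ev '' K by
    obtain ⟨A, hA, hAab⟩ := hincr
    exact ⟨A, hA, hAab.symm⟩
  by_contra hnot
  obtain ⟨l, c, hlt, hl⟩ := geometric_hahn_banach_point_closed
    (hKconv.linear_image ev.toLinearMap) (hK.image ev.continuous).isClosed hnot
  borelize E
  have hbound : ∀ᵐ u ∂(Measure.addHaar : Measure E), u ∈ U →
      c ≤ lineDeriv ℝ (l ∘ f) u (b - a) := by
    filter_upwards [hf.ae_differentiableWithinAt_of_mem] with u hu huU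
    have hdiff : DifferentiableAt ℝ f u := (hu huU).differentiableAt (hU.mem_nhds huU)
    rw [(l.differentiableAt.comp u hdiff).lineDeriv_eq_fderiv,
      (l.hasFDerivAt.comp u hdiff.hasFDerivAt).fderiv]
    exact (hl _ (mem_image_of_mem ev (hmem u huU hdiff))).le
  have hle := le_sub_of_ae_le_lineDeriv (l.lipschitz.comp_lipschitzOnWith hf) hU hUconv hbound ha
    (by rwa [add_sub_cancel])
  rw [add_sub_cancel, Function.comp_apply, Function.comp_apply, ← map_sub] at hle
  exact hlt.not_ge hle

theorem isMeanValueRegularAt_of_clarkeFDeriv (hs : s ∈ 𝓝 x) (hf : LipschitzOnWith C f s)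
    (hinv : ∀ A ∈ clarkeFDeriv f x, A.IsInvertible) : IsMeanValueRegularAt f x := by
  have hcompact : IsCompact (clarkeFDeriv f x) :=
    isCompact_convexHull (isCompact_limitingFDeriv hs hf)
  obtain ⟨ε, hε, hεinv⟩ := hcompact.exists_cthickening_subset_open ContinuousLinearEquiv.isOpen hinv
  have hnear := eventually_fderiv_mem hs hf (Metric.isOpen_thickening (δ := ε))
    ((subset_convexHull ℝ _).trans (Metric.self_subset_thickening hε _))
  obtain ⟨r, hr, hball⟩ := Metric.eventually_nhds_iff_ball.1 (hnear.and hs)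
  have hthick : Convex ℝ (Metric.cthickening ε (clarkeFDeriv f x)) :=
    (convex_convexHull ℝ _).cthickening ε
  exact ⟨_, Metric.ball x r, hcompact.cthickening, hthick, hεinv, Metric.ball_mem_nhds x hr,
    hasMeanValueSetOn_of_fderiv_mem (hf.mono fun u hu => (hball u hu).2) Metric.isOpen_ball
      (convex_ball x r) hcompact.cthickening hthick fun u hu hdiff =>
        Metric.thickening_subset_cthickening _ _ ((hball u hu).1 hdiff)⟩

end ClarkeDerivative

theorem theorem6_general {E F : Type*} [NormedAddCommGroup E] [NormedSpace ℝ E]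
    [FiniteDimensional ℝ E] [NormedAddCommGroup F] [NormedSpace ℝ F] [FiniteDimensional ℝ F]
    {f : E → F} (hf : LocallyLipschitz f) (hcoercive : Tendsto f (cobounded E) (cobounded F))
    (hinv : ∀ x, ∀ A ∈ clarkeFDeriv f x, A.IsInvertible) :
    ∃ h : E ≃ₜ F, ⇑h = f ∧ LocallyLipschitz h.symm := by
  refine exists_homeomorph_of_isMeanValueRegularAt (fun x => ?_) hcoercive
  obtain ⟨C, s, hs, hC⟩ := hf x
  exact isMeanValueRegularAt_of_clarkeFDeriv hs hC (hinv x)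

section Euclidean

variable {n : ℕ} {f : EuclideanSpace ℝ (Fin n) → EuclideanSpace ℝ (Fin n)}

theorem IsOfMaximalRank.isInvertible
    {S : Set (EuclideanSpace ℝ (Fin n) →L[ℝ] EuclideanSpace ℝ (Fin n))} (hS : IsOfMaximalRank S)
    {A : EuclideanSpace ℝ (Fin n) →L[ℝ] EuclideanSpace ℝ (Fin n)} (hA : A ∈ S) : A.IsInvertible :=
  ⟨_, A.coe_toContinuousLinearEquivOfDetNeZero (hS A hA)⟩

theorem tendsto_cobounded_of_isCoerciveFunctional {y : EuclideanSpace ℝ (Fin n)}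
    (h : IsCoerciveFunctional fun x => (1 / 2 : ℝ) * ‖f x - y‖ ^ 2) :
    Tendsto f (cobounded _) (cobounded _) := by
  rw [IsCoerciveFunctional, comap_norm_atTop] at h
  refine tendsto_norm_atTop_iff_cobounded.1 (tendsto_atTop.2 fun b => ?_)
  filter_upwards [h.eventually_ge_atTop (1 / 2 * (b + ‖y‖) ^ 2)] with x hx
  have hdist : b + ‖y‖ ≤ ‖f x - y‖ :=
    le_of_abs_le (abs_le_of_sq_le_sq (by linarith) (norm_nonneg _))
  linarith [norm_sub_le (f x) y]

end Euclidean

theorem theorem6 {n : ℕ} (f : EuclideanSpace ℝ (Fin n) → EuclideanSpace ℝ (Fin n))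
    (hf : LocallyLipschitz f)
    (hcoercive : ∀ y : EuclideanSpace ℝ (Fin n),
      IsCoerciveFunctional (fun x => (1 / 2 : ℝ) * ‖f x - y‖ ^ 2))
    (hrank : ∀ x : EuclideanSpace ℝ (Fin n), IsOfMaximalRank (clarkeJacobian f x)) :
    ∃ h : EuclideanSpace ℝ (Fin n) ≃ₜ EuclideanSpace ℝ (Fin n),
      (∀ x, h x = f x) ∧ LocallyLipschitz h.symm := by
  obtain ⟨h, rfl, hsymm⟩ := theorem6_general hf
    (tendsto_cobounded_of_isCoerciveFunctional (hcoercive 0)) fun x _ => (hrank x).isInvertible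
  exact ⟨h, fun _ => rfl, hsymm⟩
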